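/- All digraphs are finite and strict (no loops and no parallel arcs; a pair of opposite arcs $(u,v),(v,u)$ is allowed). Two vertices $u,v$ of a digraph are adjacent if at least one of $(u,v)$, $(v,u)$ is an arc. A closed ditrail of $D$ is a closed directed walk of $D$ in which no arc is repeated (vertices may be repeated). For $S\subseteq V(D)$ let $D\langle S\rangle$ be the subdigraph of $D$ induced by $S$. Say that $D$ is $S$-strictly strong if there are two distinct nonadjacent vertices $u,v\in S$ such that $D$ contains a closed ditrail through $u$ and $v$, and that $S$ is closed-trailable in $D$ if $D$ contains a closed ditrail through all vertices of $S$. For a digraph $H$, let $\delta^0(H)=\min_{v\in V(H)}\min\{d_H^+(v),d_H^-(v)\}$ be its minimum semi-degree, and let $\alpha'(H)$ be its matching number, that is, the maximum size of a matching in the underlying simple graph of $H$. Let $D$ be a digraph and let $S\subseteq V(D)$. If $D$ is $S$-strictly strong and $$\delta^0(D\langle S\rangle)\ \ge\ \alpha'(D\langle S\rangle)\ >\ 0,$$ then $S$ is closed-trailable in $D$. -/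

import Mathlib

namespace Digraph

variable {V : Type*}

/-- A strict digraph: no loops. (Parallel arcs are excluded by the type `Digraph`, since the arcs
are ordered pairs of vertices.) -/
def IsStrict (D : Digraph V) : Prop := ∀ v, ¬ D.Adj v v

/-- The subdigraph `D⟨S⟩` induced by `S`: vertex set `S`, and all arcs of `D` with both ends
in `S`. -/
def induced (D : Digraph V) (S : Set V) : Digraph S where
  Adj u v := D.Adj u v

/-- The out-neighbourhood `N⁺(v)`. -/
def outNbhd (D : Digraph V) (v : V) : Set V := {u | u ≠ v ∧ D.Adj v u}

/-- The in-neighbourhood `N⁻(v)`. -/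
def inNbhd (D : Digraph V) (v : V) : Set V := {u | u ≠ v ∧ D.Adj u v}

/-- The out-degree `d⁺(v)`. -/
noncomputable def outDeg (D : Digraph V) (v : V) : ℕ := (D.outNbhd v).ncard

/-- The in-degree `d⁻(v)`. -/
noncomputable def inDeg (D : Digraph V) (v : V) : ℕ := (D.inNbhd v).ncard

/-- The minimum semi-degree `δ⁰(D)`: the smaller of the minimum out-degree and the minimum
in-degree. -/
noncomputable def minSemiDeg (D : Digraph V) : ℕ := min (⨅ v, D.outDeg v) (⨅ v, D.inDeg v)

/-- The matching number `α'(D)`: the largest number of edges in a matching of the underlying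
graph of `D`. -/
noncomputable def matchingNumber (D : Digraph V) : ℕ :=
  sSup {n | ∃ M : D.toSimpleGraphInclusive.Subgraph, M.IsMatching ∧ M.edgeSet.ncard = n}

/-- `l = [v₁, …, vₖ]` is the vertex sequence of a ditrail: each `(vᵢ, vᵢ₊₁)` is an arc, and these
arcs are pairwise distinct. Vertices may be repeated. -/
structure IsDitrail (D : Digraph V) (l : List V) : Prop where
  ne_nil : l ≠ []
  isChain : l.IsChain D.Adj
  arcs_nodup : (l.zip l.tail).Nodup

/-- A closed ditrail: a ditrail whose initial and terminal vertices coincide; the vertex sequence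
is written as `[v₁, …, vₖ, v₁]`. -/
structure IsClosedDitrail (D : Digraph V) (l : List V) : Prop extends D.IsDitrail l where
  closed : l.head? = l.getLast?

/-- `D` is `S`-strictly strong: some closed ditrail of `D` passes through two distinct nonadjacent
vertices of `S`. -/
def IsStrictlyStrong (D : Digraph V) (S : Set V) : Prop :=
  ∃ u ∈ S, ∃ v ∈ S, u ≠ v ∧ ¬ D.Adj u v ∧ ¬ D.Adj v u ∧
    ∃ l, D.IsClosedDitrail l ∧ u ∈ l ∧ v ∈ l

/-- `S` is closed-trailable in `D`: some closed ditrail of `D` passes through all vertices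
of `S`. -/
def IsClosedTrailable (D : Digraph V) (S : Set V) : Prop :=
  ∃ l, D.IsClosedDitrail l ∧ ∀ s ∈ S, s ∈ l

end Digraph

/-!
Write `H = D⟨S⟩` and `k = α'(H)`.

If `|S| ≤ 2k + 1`, a closed ditrail of `H` covering the most vertices spans `H`. It covers more than
`k` vertices, since a dipath that cannot be extended closes up to a dicycle on at least `k + 1`
vertices. Suppose it misses a vertex, and let `P` be a dipath of `p` missed vertices that no further
missed vertex extends. At least `k + 1 - p` covered vertices send an arc to the head of `P`, and at
least `k + 1 - p` receive one from its last vertex. If these two sets meet, `P` can be inserted as a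
detour from a common vertex back to itself. Otherwise, rerouting a segment from the first set to the
second, with interior in neither, through `P` yields a closed ditrail on at least
`2(k + 1 - p) + p = 2k + 2 - p` vertices, while the old one covers at most `2k + 1 - p`.

If `|S| ≥ 2k + 2`, every maximum matching of the underlying graph misses two vertices `x ≠ y`. By
maximality `N(x)` and the set of mates of `N(y)` are disjoint sets of covered vertices. Hence
`d(x) + d(y) ≤ 2k`, so that `x` and `y` have exactly `k` neighbours, each joined to them by a pair
of opposite arcs. Exchanging matching edges, every vertex is either missed by some maximum matching
or a neighbour of `x`; as two neighbours of `x` are connected through `x`, a set of vertices closed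
under passing along pairs of opposite arcs is closed under adjacency. Take a closed ditrail through
the given nonadjacent `u` and `v` that covers an inclusion-maximal part `C` of `S`; then `C` is such
a set, since a pair of opposite arcs leaving `C` could be inserted. If `C ≠ S`, the degrees give
`|C| ≥ k + 2` and `|S \ C| ≥ k + 1`, but a maximum matching covers at most `2k` vertices and misses
at most one vertex of each of `C` and `S \ C`.
-/

namespace ClosedTrailability

open List SimpleGraph

section Lists

variable {α : Type*} {l : List α}

theorem consecutivePairs_append_cons (u : List α) (a : α) (v : List α) :
    (u ++ a :: v).consecutivePairs =
      (u ++ [a]).consecutivePairs ++ (a :: v).consecutivePairs := by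
  induction u with
  | nil => simp
  | cons c u ih =>
    cases u with
    | nil => simp [consecutivePairs]
    | cons d u => simpa [consecutivePairs] using ih

theorem consecutivePairs_map {β : Type*} (f : α → β) (l : List α) :
    (l.map f).consecutivePairs = l.consecutivePairs.map (Prod.map f f) := by
  rw [consecutivePairs, ← map_tail, zip_map]

theorem map_fst_consecutivePairs (l : List α) : l.consecutivePairs.map Prod.fst = l.dropLast := by
  induction l with
  | nil => rfl
  | cons a l ih =>
    cases l with
    | nil => rfl
    | cons b l => simpa [consecutivePairs] using ih

theorem mem_of_mem_consecutivePairs {e : α × α} (he : e ∈ l.consecutivePairs) :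
    e.1 ∈ l ∧ e.2 ∈ l :=
  (of_mem_zip he).imp_right mem_of_mem_tail

theorem exists_eq_append_cons_of_exists_mem {A : Set α} (h : ∃ x ∈ l, x ∈ A) :
    ∃ u a v, l = u ++ a :: v ∧ a ∈ A ∧ ∀ z ∈ u, z ∉ A := by
  classical
  obtain ⟨a, ha⟩ := Option.isSome_iff_exists.1
    ((find?_isSome (xs := l) (p := (· ∈ A))).2 (by simpa using h))
  obtain ⟨haA, u, v, hl, hu⟩ := find?_eq_some_iff_append.1 ha
  exact ⟨u, a, v, hl, by simpa using haA, by simpa using hu⟩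

theorem exists_segment {A B : Set α} (hAB : Disjoint A B) {c : α} (hc : c ∈ A)
    (hB : ∃ x ∈ c :: l, x ∈ B) :
    ∃ u a m b v, c :: l = u ++ a :: (m ++ b :: v) ∧ a ∈ A ∧ b ∈ B ∧ ∀ z ∈ m, z ∉ A ∪ B := by
  obtain ⟨s, b, v, hs, hb, hsB⟩ := exists_eq_append_cons_of_exists_mem hB
  have hcs : c ∈ s := by
    rcases append_eq_cons_iff.1 hs.symm with ⟨-, hbv⟩ | ⟨s', rfl, -⟩
    · exact absurd (cons_eq_cons.1 hbv).1 fun h => hAB.ne_of_mem hc hb h.symm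
    · exact mem_cons_self
  obtain ⟨m, a, u, hm, ha, hmA⟩ :=
    exists_eq_append_cons_of_exists_mem ⟨c, mem_reverse.2 hcs, hc⟩
  obtain rfl : s = u.reverse ++ a :: m.reverse := by simpa using congrArg reverse hm
  refine ⟨u.reverse, a, m.reverse, b, v, by simp [hs], ha, hb, fun z hz => ?_⟩
  simp only [Set.mem_union, not_or]
  exact ⟨hmA z (mem_reverse.1 hz), hsB z (mem_append_right _ (mem_cons_of_mem a hz))⟩

end Lists

section Ditrails

variable {V : Type*} {D : Digraph V} {l u v P : List V} {a b : V}

theorem isDitrail_append_cons : D.IsDitrail (u ++ a :: v) ↔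
    D.IsDitrail (u ++ [a]) ∧ D.IsDitrail (a :: v) ∧
      (u ++ [a]).consecutivePairs.Disjoint (a :: v).consecutivePairs := by
  have hchain : (u ++ a :: v).IsChain D.Adj ↔
    (u ++ [a]).IsChain D.Adj ∧ (a :: v).IsChain D.Adj := isChain_split
  have hpairs := nodup_append'.symm.trans
    (iff_of_eq (congrArg Nodup (consecutivePairs_append_cons u a v).symm))
  constructor
  · intro h
    obtain ⟨hu, hv⟩ := hchain.1 h.isChain
    obtain ⟨hu', hv', hdisj⟩ := hpairs.2 h.arcs_nodup
    exact ⟨⟨by simp, hu, hu'⟩, ⟨by simp, hv, hv'⟩, hdisj⟩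
  · rintro ⟨hu, hv, hdisj⟩
    exact ⟨by simp, hchain.2 ⟨hu.isChain, hv.isChain⟩,
      hpairs.1 ⟨hu.arcs_nodup, hv.arcs_nodup, hdisj⟩⟩

theorem isDitrail_append_cons_append_cons {m : List V} : D.IsDitrail (u ++ a :: (m ++ b :: v)) ↔
    (D.IsDitrail (u ++ [a]) ∧ D.IsDitrail (a :: m ++ [b]) ∧ D.IsDitrail (b :: v)) ∧
      (u ++ [a]).consecutivePairs.Disjoint (a :: m ++ [b]).consecutivePairs ∧
      (u ++ [a]).consecutivePairs.Disjoint (b :: v).consecutivePairs ∧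
      (a :: m ++ [b]).consecutivePairs.Disjoint (b :: v).consecutivePairs := by
  rw [isDitrail_append_cons, ← cons_append, isDitrail_append_cons (u := a :: m),
    consecutivePairs_append_cons (a :: m) b v, disjoint_append_right]
  tauto

theorem isClosedDitrail_map {W : Type*} {E : Digraph W} (hl : D.IsClosedDitrail l) {f : V → W}
    (hf : Function.Injective f) (hadj : ∀ a b, D.Adj a b → E.Adj (f a) (f b)) :
    E.IsClosedDitrail (l.map f) where
  ne_nil := by simpa using hl.ne_nil
  isChain := isChain_map_of_isChain f hadj hl.isChain
  arcs_nodup := (consecutivePairs_map f l).symm.subst (motive := Nodup) <|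
    hl.arcs_nodup.map (hf.prodMap hf)
  closed := by simp [hl.closed]

theorem eq_of_head?_eq_getLast? {c d : V}
    (h : (c :: (l ++ [d])).head? = (c :: (l ++ [d])).getLast?) : c = d := by
  rw [← cons_append, getLast?_concat] at h
  simpa using h

/-- A dipath, given by its nonempty vertex sequence. -/
structure IsDipath (D : Digraph V) (P : List V) : Prop where
  ne_nil : P ≠ []
  nodup : P.Nodup
  isChain : P.IsChain D.Adj

namespace IsDipath

theorem singleton (a : V) : IsDipath D [a] :=
  ⟨by simp, nodup_singleton a, isChain_singleton a⟩

theorem cons (hP : IsDipath D P) (haP : a ∉ P) (ha : D.Adj a (P.head hP.ne_nil)) :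
    IsDipath D (a :: P) := by
  refine ⟨by simp, nodup_cons.2 ⟨haP, hP.nodup⟩, isChain_cons.2 ⟨fun y hy => ?_, hP.isChain⟩⟩
  rw [head?_eq_some_head hP.ne_nil] at hy
  exact Option.some.inj hy ▸ ha

theorem isChain_append_singleton (hP : IsDipath D P) (hb : D.Adj (P.getLast hP.ne_nil) b) :
    (P ++ [b]).IsChain D.Adj := by
  refine isChain_append.2 ⟨hP.isChain, isChain_singleton b, fun y hy z hz => ?_⟩
  rw [getLast?_eq_some_getLast hP.ne_nil] at hy
  exact Option.some.inj hy ▸ Option.some.inj hz ▸ hb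

theorem append_singleton (hP : IsDipath D P) (hbP : b ∉ P)
    (hb : D.Adj (P.getLast hP.ne_nil) b) : IsDipath D (P ++ [b]) :=
  ⟨by simp, nodup_append'.2 ⟨hP.nodup, nodup_singleton b, by simpa⟩,
    hP.isChain_append_singleton hb⟩

theorem of_append_cons (hP : IsDipath D (u ++ a :: v)) : IsDipath D (a :: v) :=
  ⟨by simp, (nodup_append'.1 hP.nodup).2.1, (isChain_append.1 hP.isChain).2.1⟩

theorem isDitrail_append_singleton (hP : IsDipath D P) (hb : D.Adj (P.getLast hP.ne_nil) b) :
    D.IsDitrail (P ++ [b]) where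
  ne_nil := by simp
  isChain := hP.isChain_append_singleton hb
  arcs_nodup := by
    refine Nodup.of_map Prod.fst ?_
    rw [map_fst_consecutivePairs, dropLast_concat]
    exact hP.nodup

end IsDipath

theorem mem_or_mem_of_mem_consecutivePairs_cons_append (hP : P ≠ []) {e : V × V}
    (he : e ∈ (a :: P ++ [b]).consecutivePairs) : e.1 ∈ P ∨ e.2 ∈ P := by
  obtain ⟨p, P, rfl⟩ := exists_cons_of_ne_nil hP
  rcases mem_cons.1 he with rfl | he
  · exact Or.inr mem_cons_self
  · have hmem : e.1 ∈ (p :: P ++ [b]).consecutivePairs.map Prod.fst := mem_map_of_mem he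
    rw [map_fst_consecutivePairs, dropLast_concat] at hmem
    exact Or.inl hmem

theorem isDitrail_detour (hu : D.IsDitrail (u ++ [a])) (hv : D.IsDitrail (b :: v))
    (huv : (u ++ [a]).consecutivePairs.Disjoint (b :: v).consecutivePairs) (hP : IsDipath D P)
    (hPu : P.Disjoint (u ++ [a])) (hPv : P.Disjoint (b :: v))
    (ha : D.Adj a (P.head hP.ne_nil)) (hb : D.Adj (P.getLast hP.ne_nil) b) :
    D.IsDitrail (u ++ a :: (P ++ b :: v)) := by
  have hab : IsDipath D (a :: P) := hP.cons (fun h => hPu h (by simp)) ha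
  have hlast : D.Adj ((a :: P).getLast hab.ne_nil) b := by rwa [getLast_cons hP.ne_nil]
  have hdisjoint {w : List V} (hPw : P.Disjoint w) :
      (a :: P ++ [b]).consecutivePairs.Disjoint w.consecutivePairs := by
    intro e he hew
    rcases mem_or_mem_of_mem_consecutivePairs_cons_append hP.ne_nil he with h | h
    · exact hPw h (mem_of_mem_consecutivePairs hew).1
    · exact hPw h (mem_of_mem_consecutivePairs hew).2
  exact isDitrail_append_cons_append_cons.2
    ⟨⟨hu, hab.isDitrail_append_singleton hlast, hv⟩, (hdisjoint hPu).symm, huv,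
      hdisjoint hPv⟩

theorem exists_isClosedDitrail_insert (hl : D.IsClosedDitrail l) (hal : a ∈ l) (hP : IsDipath D P)
    (hPl : P.Disjoint l) (hin : D.Adj a (P.head hP.ne_nil))
    (hout : D.Adj (P.getLast hP.ne_nil) a) :
    ∃ l', D.IsClosedDitrail l' ∧ ∀ x, x ∈ l' ↔ x ∈ l ∨ x ∈ P := by
  obtain ⟨u, v, rfl⟩ := append_of_mem hal
  obtain ⟨hu, hv, huv⟩ := isDitrail_append_cons.1 hl.toIsDitrail
  refine ⟨u ++ a :: (P ++ a :: v), ⟨isDitrail_detour hu hv huv hP ?_ ?_ hin hout, ?_⟩,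
    fun x => ?_⟩
  · exact fun x hx h => hPl hx (by grind)
  · exact fun x hx h => hPl hx (mem_append_right u h)
  · simpa [getLast?_append, getLast?_cons] using hl.closed
  · simp only [mem_append, mem_cons]
    tauto

theorem exists_isClosedDitrail_cons (hl : D.IsClosedDitrail l) (ha : a ∈ l) :
    ∃ t, D.IsClosedDitrail (a :: t) ∧ ∀ x, x ∈ a :: t ↔ x ∈ l := by
  obtain ⟨u, v, rfl⟩ := append_of_mem ha
  rcases u with _ | ⟨c, u⟩
  · exact ⟨v, hl, fun _ => Iff.rfl⟩
  rcases eq_nil_or_concat' v with rfl | ⟨v, d, rfl⟩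
  · obtain rfl := eq_of_head?_eq_getLast? hl.closed
    exact ⟨u ++ [c], hl, fun _ => Iff.rfl⟩
  · obtain rfl : c = d := eq_of_head?_eq_getLast? (l := u ++ a :: v) (by simpa using hl.closed)
    obtain ⟨hu, hv, huv⟩ := isDitrail_append_cons.1 hl.toIsDitrail
    refine ⟨v ++ c :: (u ++ [a]), ⟨?_, ?_⟩, fun x => ?_⟩
    · rw [← cons_append, isDitrail_append_cons]
      exact ⟨hv, hu, huv.symm⟩
    · simp [getLast?_cons, getLast?_append]
    · simp only [mem_append, mem_cons]
      tauto

theorem exists_isClosedDitrail_detour {A B : Set V} (hl : D.IsClosedDitrail l)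
    (hAB : Disjoint A B) (hA : ∃ x ∈ l, x ∈ A) (hB : ∃ x ∈ l, x ∈ B) (hP : IsDipath D P)
    (hPl : P.Disjoint l) (hin : ∀ a ∈ A, D.Adj a (P.head hP.ne_nil))
    (hout : ∀ b ∈ B, D.Adj (P.getLast hP.ne_nil) b) :
    ∃ l', D.IsClosedDitrail l' ∧ (∀ x ∈ P, x ∈ l') ∧ ∀ x ∈ l, x ∈ A ∪ B → x ∈ l' := by
  obtain ⟨c, hcl, hcA⟩ := hA
  obtain ⟨b₀, hbl, hb₀⟩ := hB
  obtain ⟨t, ht, htl⟩ := exists_isClosedDitrail_cons hl hcl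
  obtain ⟨u, a, m, b, v, hamb, ha, hb, hm⟩ := exists_segment hAB hcA ⟨b₀, (htl b₀).2 hbl, hb₀⟩
  rw [hamb] at ht htl
  obtain ⟨⟨hua, -, hbv⟩, -, hdisj, -⟩ := isDitrail_append_cons_append_cons.1 ht.toIsDitrail
  refine ⟨u ++ a :: (P ++ b :: v), ⟨isDitrail_detour hua hbv hdisj hP ?_ ?_ (hin a ha)
    (hout b hb), ?_⟩, fun x hx => by simp [hx], fun x hxl hx => ?_⟩
  · exact fun x hx h => hPl hx ((htl x).1 (by grind))
  · exact fun x hx h => hPl hx ((htl x).1 (by grind))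
  · simpa [getLast?_append, getLast?_cons] using ht.closed
  · have hxm : x ∉ m := fun h => hm x h hx
    have := (htl x).2 hxl
    simp only [mem_append, mem_cons] at this ⊢
    tauto

end Ditrails

section Covering

variable {V : Type*} {D : Digraph V} {l : List V} {k : ℕ}

theorem exists_isDipath_not_extendable [Finite V] (D : Digraph V) {R : Set V} (hR : R.Nonempty) :
    ∃ P, ∃ hP : IsDipath D P, (∀ x ∈ P, x ∈ R) ∧
      (∀ x ∈ R, D.Adj x (P.head hP.ne_nil) → x ∈ P) ∧
      ∀ x ∈ R, D.Adj (P.getLast hP.ne_nil) x → x ∈ P := by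
  obtain ⟨r, hr⟩ := hR
  obtain ⟨P, ⟨hP, hPR⟩, hmax⟩ := exists_maximalFor_of_wellFoundedGT
    (fun P => IsDipath D P ∧ ∀ x ∈ P, x ∈ R) (fun P => {x | x ∈ P})
    ⟨[r], .singleton r, by simpa⟩
  refine ⟨P, hP, hPR, fun x hxR hx => ?_, fun x hxR hx => ?_⟩
  · by_contra hxP
    exact hxP (hmax ⟨hP.cons hxP hx, by simpa [hxR]⟩ (by simp +contextual) mem_cons_self)
  · by_contra hxP
    exact hxP (hmax ⟨hP.append_singleton hxP hx, by simpa [or_imp, forall_and, hxR]⟩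
      (by simp +contextual) (mem_append_right P mem_cons_self))

theorem exists_isClosedDitrail_lt_ncard [Finite V] [Nonempty V] (hk : 0 < k)
    (hout : ∀ v, k ≤ D.outDeg v) : ∃ l, D.IsClosedDitrail l ∧ k < {x | x ∈ l}.ncard := by
  obtain ⟨P, hP, -, -, hlast⟩ := exists_isDipath_not_extendable D Set.univ_nonempty
  set z := P.getLast hP.ne_nil with hz
  have hmem : ∀ x ∈ D.outNbhd z, x ∈ P := fun x hx => hlast x trivial hx.2
  obtain ⟨x, hx⟩ : (D.outNbhd z).Nonempty :=
    Set.nonempty_of_ncard_ne_zero (hk.trans_le (hout z)).ne'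
  obtain ⟨u, a, m, rfl, ha, hu⟩ := exists_eq_append_cons_of_exists_mem ⟨x, hmem x hx, hx⟩
  have hzlast : (a :: m).getLast hP.of_append_cons.ne_nil = z := by
    rw [hz, getLast_append_of_right_ne_nil]
  refine ⟨a :: m ++ [a], ⟨hP.of_append_cons.isDitrail_append_singleton (hzlast ▸ ha.2), ?_⟩, ?_⟩
  · rw [getLast?_concat, cons_append, head?_cons]
  · have hsub : insert z (D.outNbhd z) ⊆ {x | x ∈ a :: m ++ [a]} := by
      refine Set.insert_subset (mem_append_left _ (hzlast ▸ getLast_mem _)) fun y hy => ?_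
      exact mem_append_left _ ((mem_append.1 (hmem y hy)).resolve_left fun h => hu y h hy)
    have hle := Set.ncard_le_ncard hsub
    rw [Set.ncard_insert_of_notMem fun h => h.1 rfl] at hle
    exact (hout z).trans_lt hle

theorem ncard_lt_ncard_inter_add_ncard {α : Type*} [Finite α] {N X P : Set α} {h : α}
    (hP : h ∈ P) (hN : h ∉ N) (hsub : N ⊆ X ∪ P) : N.ncard < (N ∩ X).ncard + P.ncard := by
  have hinsert : insert h N ⊆ (N ∩ X) ∪ P :=
    Set.insert_subset (Or.inr hP) fun x hx => (hsub hx).imp_left fun hxX => ⟨hx, hxX⟩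
  have hle := (Set.ncard_le_ncard hinsert).trans (Set.ncard_union_le _ _)
  rwa [Set.ncard_insert_of_notMem hN] at hle

theorem exists_isClosedDitrail_ncard_lt [Finite V] (hcard : Nat.card V ≤ 2 * k + 1)
    (hout : ∀ v, k ≤ D.outDeg v) (hin : ∀ v, k ≤ D.inDeg v) (hl : D.IsClosedDitrail l)
    (hkl : k < {x | x ∈ l}.ncard) (hne : ∃ v, v ∉ l) :
    ∃ l', D.IsClosedDitrail l' ∧ {x | x ∈ l}.ncard < {x | x ∈ l'}.ncard := by
  obtain ⟨P, hP, hPl, hhead, hlast⟩ := exists_isDipath_not_extendable D (R := {x | x ∉ l}) hne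
  set A := D.inNbhd (P.head hP.ne_nil) ∩ {x | x ∈ l}
  set B := D.outNbhd (P.getLast hP.ne_nil) ∩ {x | x ∈ l}
  have hdisj : Disjoint {x | x ∈ l} {x | x ∈ P} := Set.disjoint_right.2 hPl
  have hlP : {x | x ∈ l}.ncard + {x | x ∈ P}.ncard ≤ Nat.card V := by
    rw [← Set.ncard_union_eq hdisj]
    exact Set.ncard_le_card _
  have hA : k < A.ncard + {x | x ∈ P}.ncard :=
    (hin _).trans_lt <| ncard_lt_ncard_inter_add_ncard (head_mem hP.ne_nil) (fun h => h.1 rfl)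
      fun x hx => or_iff_not_imp_left.2 fun hxl => hhead x hxl hx.2
  have hB : k < B.ncard + {x | x ∈ P}.ncard :=
    (hout _).trans_lt <| ncard_lt_ncard_inter_add_ncard (getLast_mem hP.ne_nil) (fun h => h.1 rfl)
      fun x hx => or_iff_not_imp_left.2 fun hxl => hlast x hxl hx.2
  by_cases hAB : Disjoint A B
  · obtain ⟨a, ha⟩ : A.Nonempty := Set.nonempty_of_ncard_ne_zero (by omega)
    obtain ⟨b, hb⟩ : B.Nonempty := Set.nonempty_of_ncard_ne_zero (by omega)
    obtain ⟨l', hl', hPl', hABl'⟩ := exists_isClosedDitrail_detour hl hAB ⟨a, ha.2, ha⟩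
      ⟨b, hb.2, hb⟩ hP hPl (fun x hx => hx.1.2) fun x hx => hx.1.2
    have hABl : A ∪ B ⊆ {x | x ∈ l} :=
      Set.union_subset Set.inter_subset_right Set.inter_subset_right
    have hsub : A ∪ B ∪ {x | x ∈ P} ⊆ {x | x ∈ l'} :=
      Set.union_subset (fun x hx => hABl' x (hABl hx) hx) hPl'
    have hle := Set.ncard_le_ncard hsub
    rw [Set.ncard_union_eq (hdisj.mono_left hABl), Set.ncard_union_eq hAB] at hle
    exact ⟨l', hl', by omega⟩
  · obtain ⟨a, haA, haB⟩ := Set.not_disjoint_iff.1 hAB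
    obtain ⟨l', hl', hmem⟩ := exists_isClosedDitrail_insert hl haA.2 hP hPl haA.1.2 haB.1.2
    have hsub : {x | x ∈ l} ⊂ {x | x ∈ l'} :=
      ⟨fun x hx => (hmem x).2 (Or.inl hx), fun h => hPl _ (head_mem hP.ne_nil)
        (h ((hmem _).2 (Or.inr (head_mem hP.ne_nil))))⟩
    exact ⟨l', hl', Set.ncard_lt_ncard hsub⟩

theorem exists_spanning_isClosedDitrail [Finite V] [Nonempty V] (hk : 0 < k)
    (hcard : Nat.card V ≤ 2 * k + 1) (hout : ∀ v, k ≤ D.outDeg v) (hin : ∀ v, k ≤ D.inDeg v) :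
    ∃ l, D.IsClosedDitrail l ∧ ∀ v, v ∈ l := by
  obtain ⟨l₀, hl₀, hkl₀⟩ := exists_isClosedDitrail_lt_ncard hk hout
  obtain ⟨_, ⟨l, hl, rfl⟩, hmax⟩ :=
    Set.exists_max_image ((fun l => {x | x ∈ l}) '' {l | D.IsClosedDitrail l}) Set.ncard
      (Set.toFinite _) ⟨_, l₀, hl₀, rfl⟩
  refine ⟨l, hl, ?_⟩
  by_contra! hne
  obtain ⟨l', hl', hlt⟩ := exists_isClosedDitrail_ncard_lt hcard hout hin hl
    (hkl₀.trans_le (hmax _ ⟨l₀, hl₀, rfl⟩)) hne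
  exact hlt.not_ge (hmax _ ⟨l', hl', rfl⟩)

theorem exists_isClosedDitrail_neighborSet_toSimpleGraphStrict_subset (S : Set V) [Finite S]
    {l₀ : List V} (hl₀ : D.IsClosedDitrail l₀) :
    ∃ l, D.IsClosedDitrail l ∧ (∀ x ∈ S, x ∈ l₀ → x ∈ l) ∧
      ∀ a ∈ {w : S | ↑w ∈ l}, (D.induced S).toSimpleGraphStrict.neighborSet a ⊆ {w | ↑w ∈ l} := by
  obtain ⟨l, ⟨hl, hl₀l⟩, hmax⟩ := exists_maximalFor_of_wellFoundedGT
    (fun l => D.IsClosedDitrail l ∧ ∀ x ∈ S, x ∈ l₀ → x ∈ l) (fun l => {w : S | ↑w ∈ l})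
    ⟨l₀, hl₀, fun _ _ h => h⟩
  refine ⟨l, hl, hl₀l, fun a ha b hab => ?_⟩
  by_contra hb
  obtain ⟨l', hl', hmem⟩ := exists_isClosedDitrail_insert hl ha
    (.singleton (b : V)) (by simpa using hb) hab.2.1 hab.2.2
  refine hb (hmax ⟨hl', fun x hxS hx => (hmem x).2 (Or.inl (hl₀l x hxS hx))⟩ ?_ ?_)
  · exact fun w hw => (hmem w).2 (Or.inl hw)
  · exact (hmem b).2 (Or.inr mem_cons_self)

end Covering


section Matching

variable {V : Type*} {G : SimpleGraph V} {M : G.Subgraph} {v w x y : V}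

theorem exists_isMatching_verts_eq_diff_pair (hM : M.IsMatching) (hvw : M.Adj v w) :
    ∃ M' : G.Subgraph, M'.IsMatching ∧ M'.verts = M.verts \ {v, w} := by
  refine ⟨M.deleteVerts {v, w}, fun a ⟨haM, hane⟩ => ?_, rfl⟩
  obtain ⟨b, hab, hb⟩ := hM haM
  refine ⟨b, ?_, fun c hc => hb c (Subgraph.deleteVerts_adj.1 hc).2.2.2.2⟩
  refine Subgraph.deleteVerts_adj.2 ⟨haM, hane, hab.snd_mem, ?_, hab⟩
  rintro (rfl | rfl)
  · exact hane (Or.inr (hM.eq_of_adj_right hab hvw.symm))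
  · exact hane (Or.inl (hM.eq_of_adj_right hab hvw))

theorem exists_isMatching_verts_eq_insert_pair (hM : M.IsMatching) (hxy : G.Adj x y)
    (hx : x ∉ M.verts) (hy : y ∉ M.verts) :
    ∃ M' : G.Subgraph, M'.IsMatching ∧ M'.verts = insert x (insert y M.verts) := by
  refine ⟨M ⊔ G.subgraphOfAdj hxy, hM.sup (.subgraphOfAdj hxy) ?_, ?_⟩
  · rw [hM.support_eq_verts, support_subgraphOfAdj, Set.disjoint_right]
    rintro _ (rfl | rfl)
    exacts [hx, hy]
  · ext z
    simp only [Subgraph.verts_sup, subgraphOfAdj_verts, Set.mem_union, Set.mem_insert_iff,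
      Set.mem_singleton_iff]
    tauto

theorem exists_isMatching_verts_eq_exchange (hM : M.IsMatching) (hvw : M.Adj v w)
    (hx : x ∉ M.verts) (hxw : G.Adj x w) :
    ∃ M' : G.Subgraph, M'.IsMatching ∧ M'.verts = insert x (M.verts \ {v}) := by
  obtain ⟨M₀, hM₀, hverts₀⟩ := exists_isMatching_verts_eq_diff_pair hM hvw
  obtain ⟨M', hM', hverts'⟩ := exists_isMatching_verts_eq_insert_pair hM₀ hxw
    (fun h => hx (hverts₀.subset h).1) (fun h => (hverts₀.subset h).2 (Or.inr rfl))
  refine ⟨M', hM', ?_⟩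
  have hwM : w ∈ M.verts \ {v} := ⟨hvw.snd_mem, (M.adj_sub hvw).ne'⟩
  rw [hverts', hverts₀, Set.insert_eq v, ← Set.sdiff_sdiff, Set.insert_sdiff_singleton,
    Set.insert_eq_of_mem hwM]

theorem exists_isMatching_verts_eq_augment (hM : M.IsMatching) (hvw : M.Adj v w)
    (hx : x ∉ M.verts) (hy : y ∉ M.verts) (hxy : x ≠ y) (hxv : G.Adj x v) (hyw : G.Adj y w) :
    ∃ M' : G.Subgraph, M'.IsMatching ∧ M'.verts = insert x (insert y M.verts) := by
  obtain ⟨M₁, hM₁, hverts₁⟩ := exists_isMatching_verts_eq_exchange hM hvw.symm hx hxv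
  have hwx : w ≠ x := fun h => hx (h ▸ hvw.snd_mem)
  obtain ⟨M', hM', hverts'⟩ := exists_isMatching_verts_eq_insert_pair hM₁ hyw
    (by simp [hverts₁, hxy.symm, hy]) (by simp [hverts₁, hwx])
  refine ⟨M', hM', ?_⟩
  rw [hverts', hverts₁, Set.insert_comm w, Set.insert_sdiff_singleton,
    Set.insert_eq_of_mem hvw.snd_mem, Set.insert_comm]

/-- The set of vertices that the matching `M` matches with a vertex of `A`. -/
def mates (M : G.Subgraph) (A : Set V) : Set V := {w | ∃ v ∈ A, M.Adj v w}

theorem ncard_mates (hM : M.IsMatching) {A : Set V} (hA : A ⊆ M.verts) :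
    (mates M A).ncard = A.ncard := by
  have hmate : ∀ v (hv : v ∈ A), M.Adj v (hM (hA hv)).choose :=
    fun v hv => (hM (hA hv)).choose_spec.1
  refine (Set.ncard_congr (fun v hv => (hM (hA hv)).choose) (fun v hv => ?_)
    (fun v w hv hw h => ?_) ?_).symm
  · exact ⟨v, hv, hmate v hv⟩
  · exact hM.eq_of_adj_right (hmate v hv) (h ▸ hmate w hw)
  · rintro w ⟨v, hv, hvw⟩
    exact ⟨v, hv, hM.eq_of_adj_left (hmate v hv) hvw⟩

/-- A maximum matching. Its size is measured by the number of covered vertices, which is twice the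
number of edges. -/
structure IsMaximumMatching (M : G.Subgraph) : Prop where
  isMatching : M.IsMatching
  ncard_verts_le : ∀ M' : G.Subgraph, M'.IsMatching → M'.verts.ncard ≤ M.verts.ncard

theorem IsMaximumMatching.exchange (hM : IsMaximumMatching M) (hvw : M.Adj v w) (hx : x ∉ M.verts)
    (hxw : G.Adj x w) :
    ∃ M' : G.Subgraph, IsMaximumMatching M' ∧ v ∉ M'.verts := by
  obtain ⟨M', hM', hverts⟩ := exists_isMatching_verts_eq_exchange hM.isMatching hvw hx hxw
  have hvx : v ≠ x := fun h => hx (h ▸ hvw.fst_mem)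
  have hcard : M'.verts.ncard = M.verts.ncard := by
    rw [hverts, Set.ncard_exchange hx hvw.fst_mem]
  exact ⟨M', ⟨hM', fun N hN => hcard ▸ hM.ncard_verts_le N hN⟩, by simp [hverts, hvx]⟩

variable [Finite V]

theorem ncard_verts_le_two_mul_ncard_edgeSet (hM : M.IsMatching) :
    M.verts.ncard ≤ 2 * M.edgeSet.ncard := by
  classical
  have hfin : M.edgeSet.Finite := Set.toFinite _
  have hverts : M.verts = (hfin.toFinset.biUnion Sym2.toFinset : Finset V) := by
    ext v
    simp [hM.verts_eq_biUnion_edgeSet]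
  rw [hverts, Set.ncard_coe_finset, Set.ncard_eq_toFinset_card _ hfin, mul_comm]
  refine Finset.card_biUnion_le_card_mul _ _ _ fun e _ => ?_
  rw [Sym2.card_toFinset]
  split_ifs <;> simp

theorem exists_isMaximumMatching (G : SimpleGraph V) : ∃ M : G.Subgraph, IsMaximumMatching M := by
  obtain ⟨M, hM, hmax⟩ := Set.exists_max_image {M : G.Subgraph | M.IsMatching}
    (fun M => M.verts.ncard) (Set.toFinite _) ⟨⊥, by simp [Subgraph.IsMatching]⟩
  exact ⟨M, hM, hmax⟩

namespace IsMaximumMatching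

theorem verts_ne_insert_insert (hM : IsMaximumMatching M) {M' : G.Subgraph} (hM' : M'.IsMatching)
    (hx : x ∉ M.verts) : M'.verts ≠ insert x (insert y M.verts) := by
  intro h
  have hsub : insert x M.verts ⊆ M'.verts :=
    h ▸ Set.insert_subset_insert (Set.subset_insert y M.verts)
  have hle := (Set.ncard_le_ncard hsub).trans (hM.ncard_verts_le M' hM')
  rw [Set.ncard_insert_of_notMem hx] at hle
  omega

theorem neighborSet_subset_verts (hM : IsMaximumMatching M) (hx : x ∉ M.verts) :
    G.neighborSet x ⊆ M.verts := by
  intro y hxy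
  by_contra hy
  obtain ⟨M', hM', hverts⟩ := exists_isMatching_verts_eq_insert_pair hM.isMatching hxy hx hy
  exact hM.verts_ne_insert_insert hM' hx hverts

theorem disjoint_neighborSet_mates (hM : IsMaximumMatching M) (hx : x ∉ M.verts)
    (hy : y ∉ M.verts) (hxy : x ≠ y) :
    Disjoint (G.neighborSet x) (mates M (G.neighborSet y)) := by
  rw [Set.disjoint_left]
  rintro v hxv ⟨w, hyw, hwv⟩
  obtain ⟨M', hM', hverts⟩ :=
    exists_isMatching_verts_eq_augment hM.isMatching hwv.symm hx hy hxy hxv hyw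
  exact hM.verts_ne_insert_insert hM' hx hverts

theorem neighborSet_union_mates_subset (hM : IsMaximumMatching M) (hx : x ∉ M.verts) :
    G.neighborSet x ∪ mates M (G.neighborSet y) ⊆ M.verts :=
  Set.union_subset (hM.neighborSet_subset_verts hx) fun _ ⟨_, _, h⟩ => h.snd_mem

theorem ncard_neighborSet_union_mates (hM : IsMaximumMatching M) (hx : x ∉ M.verts)
    (hy : y ∉ M.verts) (hxy : x ≠ y) :
    (G.neighborSet x ∪ mates M (G.neighborSet y)).ncard =
      (G.neighborSet x).ncard + (G.neighborSet y).ncard := by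
  rw [Set.ncard_union_eq (hM.disjoint_neighborSet_mates hx hy hxy),
    ncard_mates hM.isMatching (hM.neighborSet_subset_verts hy)]

theorem ncard_neighborSet_add_ncard_neighborSet_le (hM : IsMaximumMatching M) (hx : x ∉ M.verts)
    (hy : y ∉ M.verts) (hxy : x ≠ y) :
    (G.neighborSet x).ncard + (G.neighborSet y).ncard ≤ M.verts.ncard := by
  rw [← hM.ncard_neighborSet_union_mates hx hy hxy]
  exact Set.ncard_le_ncard (hM.neighborSet_union_mates_subset hx)

theorem adj_or_adj (hM : IsMaximumMatching M) (hx : x ∉ M.verts) (hy : y ∉ M.verts) (hxy : x ≠ y)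
    (hdeg : M.verts.ncard ≤ (G.neighborSet x).ncard + (G.neighborSet y).ncard)
    (hvw : M.Adj v w) : G.Adj x v ∨ G.Adj y w := by
  have hunion : G.neighborSet x ∪ mates M (G.neighborSet y) = M.verts :=
    Set.eq_of_subset_of_ncard_le (hM.neighborSet_union_mates_subset hx)
      (hdeg.trans_eq (hM.ncard_neighborSet_union_mates hx hy hxy).symm)
  refine (hunion.superset hvw.fst_mem).imp_right fun ⟨u, hyu, huv⟩ => ?_
  rwa [hM.isMatching.eq_of_adj_right hvw.symm huv]

theorem exists_isMaximumMatching_notMem_verts_or_adj (hM : IsMaximumMatching M) (hx : x ∉ M.verts)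
    (hy : y ∉ M.verts) (hxy : x ≠ y)
    (hdeg : M.verts.ncard ≤ (G.neighborSet x).ncard + (G.neighborSet y).ncard) (v : V) :
    (∃ M' : G.Subgraph, IsMaximumMatching M' ∧ v ∉ M'.verts) ∨ G.Adj x v := by
  by_cases hv : v ∈ M.verts
  · obtain ⟨w, hvw, -⟩ := hM.isMatching hv
    rcases hM.adj_or_adj hx hy hxy hdeg hvw with hxv | hyw
    · exact Or.inr hxv
    · exact Or.inl (hM.exchange hvw hy hyw)
  · exact Or.inl ⟨M, hM, hv⟩

variable {k : ℕ} {C : Set V}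

theorem eq_univ_of_uncovered_pair_mem (hM : IsMaximumMatching M) (hk : 0 < k)
    (hdeg : ∀ v, k ≤ (G.neighborSet v).ncard) (hMk : M.verts.ncard ≤ 2 * k)
    (hC : ∀ v ∈ C, G.neighborSet v ⊆ C) (hx : x ∉ M.verts) (hy : y ∉ M.verts) (hxy : x ≠ y)
    (hxC : x ∈ C) (hyC : y ∈ C) : C = Set.univ := by
  have hcovered : M.verts ⊆ C := by
    intro v hv
    obtain ⟨w, hvw, -⟩ := hM.isMatching hv
    have hsum : M.verts.ncard ≤ (G.neighborSet x).ncard + (G.neighborSet y).ncard := by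
      have := hdeg x
      have := hdeg y
      omega
    rcases hM.adj_or_adj hx hy hxy hsum hvw with hxv | hyw
    · exact hC x hxC hxv
    · exact hC w (hC y hyC hyw) (M.adj_sub hvw).symm
  refine Set.eq_univ_of_forall fun v => ?_
  by_cases hv : v ∈ M.verts
  · exact hcovered hv
  · obtain ⟨w, hvw⟩ := Set.nonempty_of_ncard_ne_zero (hk.trans_le (hdeg v)).ne'
    exact hC w (hcovered (hM.neighborSet_subset_verts hv hvw)) (G.adj_symm hvw)

theorem ncard_sdiff_verts_le_one (hM : IsMaximumMatching M) (hk : 0 < k)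
    (hdeg : ∀ v, k ≤ (G.neighborSet v).ncard) (hMk : M.verts.ncard ≤ 2 * k)
    (hC : ∀ v ∈ C, G.neighborSet v ⊆ C) (hne : C ≠ Set.univ) : (C \ M.verts).ncard ≤ 1 := by
  rw [Set.ncard_le_one_iff]
  rintro x y ⟨hxC, hx⟩ ⟨hyC, hy⟩
  by_contra hxy
  exact hne (hM.eq_univ_of_uncovered_pair_mem hk hdeg hMk hC hx hy hxy hxC hyC)

theorem eq_univ_of_not_adj (hM : IsMaximumMatching M) (hk : 0 < k)
    (hdeg : ∀ v, k ≤ (G.neighborSet v).ncard) (hMk : M.verts.ncard ≤ 2 * k)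
    (hC : ∀ v ∈ C, G.neighborSet v ⊆ C) (hxC : x ∈ C) (hyC : y ∈ C) (hxy : x ≠ y)
    (hnadj : ¬ G.Adj x y) : C = Set.univ := by
  by_contra hne
  obtain ⟨z, hzC⟩ := (Set.ne_univ_iff_exists_notMem C).1 hne
  have hCc : ∀ v ∈ Cᶜ, G.neighborSet v ⊆ Cᶜ := fun v hv w hvw hw => hv (hC w hw (G.adj_symm hvw))
  have hCcard : k + 2 ≤ C.ncard := by
    have hsub : insert x (insert y (G.neighborSet x)) ⊆ C :=
      Set.insert_subset hxC (Set.insert_subset hyC (hC x hxC))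
    have hle := Set.ncard_le_ncard hsub
    rw [Set.ncard_insert_of_notMem (by simp [hxy]), Set.ncard_insert_of_notMem (by simpa)] at hle
    have := hdeg x
    omega
  have hCccard : k + 1 ≤ Cᶜ.ncard := by
    have hle := Set.ncard_le_ncard (Set.insert_subset hzC (hCc z hzC))
    rw [Set.ncard_insert_of_notMem (by simp)] at hle
    have := hdeg z
    omega
  have hcard : Cᶜ.ncard + C.ncard ≤ M.verts.ncard + 2 := by
    have hmissed := hM.ncard_sdiff_verts_le_one hk hdeg hMk hC hne
    have hmissed' := hM.ncard_sdiff_verts_le_one hk hdeg hMk hCc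
      fun h => h.superset (Set.mem_univ x) hxC
    have hsplit := Set.ncard_inter_add_ncard_sdiff_eq_ncard C M.verts
    have hsplit' := Set.ncard_inter_add_ncard_sdiff_eq_ncard Cᶜ M.verts
    have hsplit_verts := Set.ncard_inter_add_ncard_sdiff_eq_ncard M.verts C
    rw [Set.inter_comm, Set.sdiff_eq_compl_inter] at hsplit_verts
    omega
  omega

end IsMaximumMatching

end Matching

section SemiDegree

variable {V : Type*} {D : Digraph V} {k : ℕ} {x y z : V}

theorem outNbhd_subset_neighborSet (D : Digraph V) (x : V) :
    D.outNbhd x ⊆ D.toSimpleGraphInclusive.neighborSet x :=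
  fun _ hz => ⟨hz.1.symm, Or.inl hz.2⟩

theorem inNbhd_subset_neighborSet (D : Digraph V) (x : V) :
    D.inNbhd x ⊆ D.toSimpleGraphInclusive.neighborSet x :=
  fun _ hz => ⟨hz.1.symm, Or.inr hz.2⟩

variable [Finite V]

theorem le_ncard_neighborSet (hout : ∀ v, k ≤ D.outDeg v) (x : V) :
    k ≤ (D.toSimpleGraphInclusive.neighborSet x).ncard :=
  (hout x).trans (Set.ncard_le_ncard (outNbhd_subset_neighborSet D x))

theorem ncard_verts_le_two_mul_matchingNumber {M : D.toSimpleGraphInclusive.Subgraph}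
    (hM : M.IsMatching) : M.verts.ncard ≤ 2 * D.matchingNumber := by
  refine (ncard_verts_le_two_mul_ncard_edgeSet hM).trans (Nat.mul_le_mul_left 2 ?_)
  refine le_csSup ⟨Nat.card (Sym2 V), ?_⟩ ⟨M, hM, rfl⟩
  rintro _ ⟨M', -, rfl⟩
  exact Set.ncard_le_card M'.edgeSet

variable (hout : ∀ v, k ≤ D.outDeg v) (hin : ∀ v, k ≤ D.inDeg v)

include hout hin

theorem toSimpleGraphStrict_adj_of_ncard_neighborSet_le
    (hx : (D.toSimpleGraphInclusive.neighborSet x).ncard ≤ k)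
    (hxz : D.toSimpleGraphInclusive.Adj x z) : D.toSimpleGraphStrict.Adj x z := by
  have hxout : D.outNbhd x = D.toSimpleGraphInclusive.neighborSet x :=
    Set.eq_of_subset_of_ncard_le (outNbhd_subset_neighborSet D x) (hx.trans (hout x))
  have hxin : D.inNbhd x = D.toSimpleGraphInclusive.neighborSet x :=
    Set.eq_of_subset_of_ncard_le (inNbhd_subset_neighborSet D x) (hx.trans (hin x))
  exact ⟨hxz.ne, (hxout.superset hxz).2, (hxin.superset hxz).2⟩

variable (hmatch : ∀ M : D.toSimpleGraphInclusive.Subgraph, M.IsMatching → M.verts.ncard ≤ 2 * k)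
  (hcard : 2 * k + 1 < Nat.card V)

include hmatch hcard

theorem toSimpleGraphStrict_adj_of_notMem_verts {M : D.toSimpleGraphInclusive.Subgraph}
    (hM : IsMaximumMatching M) (hx : x ∉ M.verts) (hxz : D.toSimpleGraphInclusive.Adj x z) :
    D.toSimpleGraphStrict.Adj x z := by
  have hMk := hmatch M hM.isMatching
  have huncovered : 1 < M.vertsᶜ.ncard := by
    have := Set.ncard_add_ncard_compl M.verts
    omega
  obtain ⟨y, hy, hyx⟩ := Set.exists_ne_of_one_lt_ncard huncovered x
  have hsum := hM.ncard_neighborSet_add_ncard_neighborSet_le hx hy hyx.symm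
  have hky := le_ncard_neighborSet hout y
  exact toSimpleGraphStrict_adj_of_ncard_neighborSet_le hout hin (by omega) hxz

theorem neighborSet_toSimpleGraphInclusive_subset {C : Set V}
    (hC : ∀ v ∈ C, D.toSimpleGraphStrict.neighborSet v ⊆ C) :
    ∀ v ∈ C, D.toSimpleGraphInclusive.neighborSet v ⊆ C := by
  obtain ⟨M, hM⟩ := exists_isMaximumMatching D.toSimpleGraphInclusive
  have hMk := hmatch M hM.isMatching
  obtain ⟨x, y, hx, hy, hxy⟩ : ∃ x y, x ∉ M.verts ∧ y ∉ M.verts ∧ x ≠ y := by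
    have huncovered : 1 < M.vertsᶜ.ncard := by
      have := Set.ncard_add_ncard_compl M.verts
      omega
    obtain ⟨x, hx, y, hy, hxy⟩ := (Set.one_lt_ncard).1 huncovered
    exact ⟨x, y, hx, hy, hxy⟩
  have hsum : M.verts.ncard ≤ (D.toSimpleGraphInclusive.neighborSet x).ncard +
      (D.toSimpleGraphInclusive.neighborSet y).ncard := by
    have := le_ncard_neighborSet hout x
    have := le_ncard_neighborSet hout y
    omega
  have hmissed := hM.exists_isMaximumMatching_notMem_verts_or_adj hx hy hxy hsum
  intro v hv w hvw
  rcases hmissed v with ⟨M', hM', hvM'⟩ | hxv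
  · exact hC v hv (toSimpleGraphStrict_adj_of_notMem_verts hout hin hmatch hcard hM' hvM' hvw)
  rcases hmissed w with ⟨M', hM', hwM'⟩ | hxw
  · exact hC v hv
      (toSimpleGraphStrict_adj_of_notMem_verts hout hin hmatch hcard hM' hwM' hvw.symm).symm
  · have hxC : x ∈ C :=
      hC v hv (toSimpleGraphStrict_adj_of_notMem_verts hout hin hmatch hcard hM hx hxv).symm
    exact hC x hxC (toSimpleGraphStrict_adj_of_notMem_verts hout hin hmatch hcard hM hx hxw)

theorem eq_univ_of_neighborSet_toSimpleGraphStrict_subset (hk : 0 < k) {C : Set V}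
    (hC : ∀ v ∈ C, D.toSimpleGraphStrict.neighborSet v ⊆ C) (hxC : x ∈ C) (hyC : y ∈ C)
    (hxy : x ≠ y) (hnadj : ¬ D.toSimpleGraphInclusive.Adj x y) : C = Set.univ := by
  obtain ⟨M, hM⟩ := exists_isMaximumMatching D.toSimpleGraphInclusive
  exact hM.eq_univ_of_not_adj hk (le_ncard_neighborSet hout) (hmatch M hM.isMatching)
    (neighborSet_toSimpleGraphInclusive_subset hout hin hmatch hcard hC) hxC hyC hxy hnadj

end SemiDegree

end ClosedTrailability

open ClosedTrailability in
theorem mainTheorem3_general {V : Type*} (D : Digraph V) (S : Set V) [Finite S]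
    (hS : D.IsStrictlyStrong S)
    (hdeg : (D.induced S).matchingNumber ≤ (D.induced S).minSemiDeg)
    (hpos : 0 < (D.induced S).matchingNumber) :
    D.IsClosedTrailable S := by
  obtain ⟨u, hu, v, hv, huv, hnuv, hnvu, l₀, hl₀, hul₀, hvl₀⟩ := hS
  have : Nonempty S := ⟨⟨u, hu⟩⟩
  have hout (w : S) : (D.induced S).matchingNumber ≤ (D.induced S).outDeg w :=
    (hdeg.trans (min_le_left _ _)).trans (ciInf_le (OrderBot.bddBelow _) w)
  have hin (w : S) : (D.induced S).matchingNumber ≤ (D.induced S).inDeg w :=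
    (hdeg.trans (min_le_right _ _)).trans (ciInf_le (OrderBot.bddBelow _) w)
  rcases le_or_gt (Nat.card S) (2 * (D.induced S).matchingNumber + 1) with hcard | hcard
  · obtain ⟨l, hl, hmem⟩ := exists_spanning_isClosedDitrail hpos hcard hout hin
    exact ⟨l.map Subtype.val, isClosedDitrail_map hl Subtype.val_injective fun _ _ h => h,
      fun s hs => List.mem_map.2 ⟨⟨s, hs⟩, hmem _, rfl⟩⟩
  · obtain ⟨l, hl, hl₀l, hclosed⟩ :=
      exists_isClosedDitrail_neighborSet_toSimpleGraphStrict_subset S hl₀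
    have hnadj : ¬ (D.induced S).toSimpleGraphInclusive.Adj ⟨u, hu⟩ ⟨v, hv⟩ :=
      fun h => h.2.elim hnuv hnvu
    have huniv : {w : S | ↑w ∈ l} = Set.univ :=
      eq_univ_of_neighborSet_toSimpleGraphStrict_subset hout hin
        (fun _ => ncard_verts_le_two_mul_matchingNumber) hcard hpos hclosed
        (hl₀l u hu hul₀) (hl₀l v hv hvl₀) (by simpa using huv) hnadj
    exact ⟨l, hl, fun s hs => huniv.superset (Set.mem_univ (⟨s, hs⟩ : S))⟩

theorem mainTheorem3 {V : Type*} [Finite V] (D : Digraph V) (hD : D.IsStrict) (S : Set V)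
    (hS : D.IsStrictlyStrong S)
    (hdeg : (D.induced S).matchingNumber ≤ (D.induced S).minSemiDeg)
    (hpos : 0 < (D.induced S).matchingNumber) :
    D.IsClosedTrailable S :=
  mainTheorem3_general D S hS hdeg hpos
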